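/- Let $t=t_0t_1t_2\cdots=\lim_{q\to\infty}m^q(0)$ be the Thue–Morse word, where $m$ is the morphism $0\mapsto 01$, $1\mapsto 10$, and let $T_n$ be the set of factors of $t$ of length $n$. Two words $u,v$ are 2-abelian equivalent, $u\equiv_2 v$, if they have the same prefix of length $1$ and the same suffix of length $1$ (when non-empty), and every word $w$ of length $2$ occurs equally often in $u$ and in $v$. Let $P_n=\#(T_n/{\equiv_2})$ for $n\ge 0$. The 2-kernel of an integer sequence $(a_n)_{n\ge 0}$ is the set of subsequences $(a_{2^e n+c})_{n\ge 0}$ with $e\ge 0$, $0\le c<2^e$; the sequence is 2-regular if the $\mathbb{Z}$-module generated by its 2-kernel is finitely generated. (1) The sequence $(P_n)_{n\ge 0}$ is 2-regular. (2) For all $n\ge 0$ the following 13 relations hold: \begin{enumerate} \item $P_{4n+1}=P_{2n+1}$ \item $P_{8n+4}=P_{8n+3}+P_{4n+3}-P_{4n+2}$ \item $P_{16n}=P_{8n}$ \item $P_{16n+2}=P_{8n+2}$ \item $P_{16n+6}=-P_{16n+3}+P_{8n+3}+3P_{8n+2}+P_{4n+3}-2P_{4n+2}-P_{2n+1}$ \item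 $P_{16n+7}=-P_{16n+3}+P_{8n+3}+3P_{8n+2}+2P_{4n+3}-3P_{4n+2}-P_{2n+1}$ \item $P_{16n+8}=P_{8n+2}+P_{4n+3}-P_{2n+1}$ \item $P_{16n+10}=P_{8n+2}+P_{4n+3}-P_{2n+1}$ \item $P_{16n+11}=-P_{16n+3}+3P_{8n+2}+P_{4n+3}-2P_{2n+1}$ \item $P_{16n+14}=P_{16n+3}+P_{8n+7}-P_{8n+3}-P_{8n+2}-P_{4n+3}+3P_{4n+2}-P_{2n+1}$ \item $P_{16n+15}=P_{16n+3}+2P_{8n+7}-3P_{8n+6}-2P_{8n+3}+6P_{4n+2}-3P_{2n+1}$ \item $P_{32n+3}=P_{8n+3}$ \item $P_{32n+19}=-P_{16n+3}+P_{8n+3}+3P_{8n+2}+2P_{4n+3}-3P_{4n+2}-P_{2n+1}$ \end{enumerate} (3) These relations express every subsequence in the 2-kernel other than $(P_n)$, $(P_{2n})$ and $(P_{4n})$ as a $\mathbb{Z}$-combination of the nine subsequences $(P_{2n+1})$, $(P_{4n+2})$, $(P_{4n+3})$, $(P_{8n})$, $(P_{8n+2})$, $(P_{8n+3})$, $(P_{8n+6})$,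 $(P_{8n+7})$, $(P_{16n+3})$. More precisely, for every integer sequence $(a_n)_{n\ge 0}$ that satisfies the 13 relations for all $n\ge0$ (with $a$ in place of $P$), every $e\ge 0$ and every $0\le c<2^e$ with $(e,c)\notin\{(0,0),(1,0),(2,0)\}$, the sequence $(a_{2^e n+c})_{n\ge 0}$ lies in the $\mathbb{Z}$-span of the nine corresponding subsequences of $(a_n)$. (4) Consequently the $\mathbb{Z}$-module generated by the 2-kernel of $(P_n)_{n\ge 0}$ is generated by these nine subsequences together with $(P_n)$, $(P_{2n})$ and $(P_{4n})$. -/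

import Mathlib

namespace TwoAbelian

section Words

variable {A : Type*}

/-- The finite factors of length `n` of the infinite word `w = w 0, w 1, w 2, …`
(the set `T_n` when `w` is the Thue–Morse word). -/
def factors (w : ℕ → A) (n : ℕ) : Set (List A) :=
  {u | ∃ i : ℕ, u = (List.range n).map fun j => w (i + j)}

/-- The prefix of length `l` of `u` (all of `u` if `u` is shorter). -/
def pref (l : ℕ) (u : List A) : List A := u.take l

/-- The suffix of length `l` of `u` (all of `u` if `u` is shorter). -/
def suff (l : ℕ) (u : List A) : List A := u.drop (u.length - l)

/-- `|u|_v`: the number of (possibly overlapping) occurrences of `v` in `u`, that is, the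
number of suffixes of `u` which start with `v`. -/
def occ [DecidableEq A] (v u : List A) : ℕ := u.tails.countP fun s => decide (v <+: s)

/-- `l`-abelian equivalence (for `l ≥ 1`) of finite words. -/
def AbEquiv [DecidableEq A] (l : ℕ) (u v : List A) : Prop :=
  (pref (l - 1) u = pref (l - 1) v ∧ suff (l - 1) u = suff (l - 1) v) ∧
    ∀ w : List A, w.length = l → occ w u = occ w v

/-- `l`-abelian equivalence as an equivalence relation on the factors of length `n` of `w`. -/
def abSetoid [DecidableEq A] (l : ℕ) (w : ℕ → A) (n : ℕ) : Setoid (factors w n) where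
  r u v := AbEquiv l u.1 v.1
  iseqv :=
    { refl := fun _ => ⟨⟨rfl, rfl⟩, fun _ _ => rfl⟩
      symm := fun h => ⟨⟨h.1.1.symm, h.1.2.symm⟩, fun w hw => (h.2 w hw).symm⟩
      trans := fun h h' =>
        ⟨⟨h.1.1.trans h'.1.1, h.1.2.trans h'.1.2⟩, fun w hw => (h.2 w hw).trans (h'.2 w hw)⟩ }

/-- The `l`-abelian complexity of the infinite word `w`: the number of classes of
`l`-abelian equivalence on its factors of length `n`.  (Over a finite alphabet there are
finitely many factors of length `n`, so `Nat.card` is the true number of classes.) -/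
noncomputable def abComplexity [DecidableEq A] (l : ℕ) (w : ℕ → A) (n : ℕ) : ℕ :=
  Nat.card (Quotient (abSetoid l w n))

end Words

section ThueMorse

/-- The Thue–Morse morphism `0 ↦ 01`, `1 ↦ 10` on finite binary words. -/
def tmMorphism (u : List (Fin 2)) : List (Fin 2) :=
  u.flatMap fun a => if a = 0 then [0, 1] else [1, 0]

/-- The word `m^q(0)`, of length `2^q`. -/
def tmPrefix (q : ℕ) : List (Fin 2) := tmMorphism^[q] [0]

/-- The infinite Thue–Morse word `t = lim m^q(0)`: its letter `t_n` is the letter with index `n`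
of `m^n(0)`, a word of length `2^n > n`.  That every `m^q(0)` is a prefix of `t` is
`tmPrefix_eq`. -/
def thueMorse (n : ℕ) : Fin 2 := (tmPrefix n).getD n 0

theorem length_tmMorphism (u : List (Fin 2)) : (tmMorphism u).length = 2 * u.length := by
  induction u with
  | nil => rfl
  | cons a u ih =>
    have h : tmMorphism (a :: u) = (if a = 0 then [0, 1] else [1, 0]) ++ tmMorphism u := rfl
    rw [h, List.length_append, ih]
    split_ifs <;> simp <;> omega

theorem tmPrefix_succ (q : ℕ) : tmPrefix (q + 1) = tmMorphism (tmPrefix q) :=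
  Function.iterate_succ_apply' _ _ _

theorem length_tmPrefix (q : ℕ) : (tmPrefix q).length = 2 ^ q := by
  induction q with
  | zero => rfl
  | succ q ih => rw [tmPrefix_succ, length_tmMorphism, ih, pow_succ, mul_comm]

theorem tmPrefix_prefix_succ (q : ℕ) : tmPrefix q <+: tmPrefix (q + 1) := by
  induction q with
  | zero => exact ⟨[1], rfl⟩
  | succ q ih =>
    obtain ⟨s, hs⟩ := ih
    refine ⟨tmMorphism s, ?_⟩
    have h : tmMorphism (tmPrefix q ++ s) = tmMorphism (tmPrefix q) ++ tmMorphism s := by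
      simp [tmMorphism]
    rw [tmPrefix_succ (q + 1), ← hs, h, hs, tmPrefix_succ q]

theorem tmPrefix_prefix {p q : ℕ} (h : p ≤ q) : tmPrefix p <+: tmPrefix q := by
  induction q, h using Nat.le_induction with
  | base => exact List.prefix_rfl
  | succ q _ ih => exact ih.trans (tmPrefix_prefix_succ q)

/-- Every `m^q(0)` is the prefix of length `2^q` of the Thue–Morse word. -/
theorem tmPrefix_eq (q : ℕ) : tmPrefix q = (List.range (2 ^ q)).map thueMorse := by
  have key : ∀ {p q i : ℕ}, p ≤ q → i < 2 ^ p → (tmPrefix p)[i]? = (tmPrefix q)[i]? := by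
    intro p q i h hi
    obtain ⟨s, hs⟩ := tmPrefix_prefix h
    rw [← hs, List.getElem?_append_left (by rw [length_tmPrefix]; exact hi)]
  apply List.ext_getElem
  · simp [length_tmPrefix]
  · intro i h1 h2
    have hq : i < 2 ^ q := by rwa [length_tmPrefix] at h1
    have hi : i < 2 ^ i := Nat.lt_two_pow_self
    have e : (tmPrefix i)[i]? = (tmPrefix q)[i]? := by
      rcases le_total i q with h | h
      · exact key h hi
      · exact (key h hq).symm
    simp [thueMorse, List.getD_eq_getElem?_getD, e, List.getElem?_eq_getElem h1]

/-- `P_n`, the 2-abelian complexity of the Thue–Morse word, as an integer sequence. -/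
noncomputable def P (n : ℕ) : ℤ := (abComplexity 2 thueMorse n : ℤ)

end ThueMorse

section Regular

/-- The subsequence `(a (p n + c))_{n ≥ 0}`. -/
def subseq (a : ℕ → ℤ) (p c : ℕ) : ℕ → ℤ := fun n => a (p * n + c)

/-- The `k`-kernel of an integer sequence. -/
def kernel (k : ℕ) (a : ℕ → ℤ) : Set (ℕ → ℤ) :=
  {b | ∃ e c : ℕ, c < k ^ e ∧ b = subseq a (k ^ e) c}

/-- `k`-regularity (for `k ≥ 2`): the `ℤ`-module generated by the `k`-kernel is finitely
generated. -/
def IsRegular (k : ℕ) (a : ℕ → ℤ) : Prop := (Submodule.span ℤ (kernel k a)).FG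

/-- The 13 linear relations, for an integer sequence `a`. -/
def Relations (a : ℕ → ℤ) : Prop :=
  (∀ n, a (4 * n + 1) = a (2 * n + 1)) ∧
  (∀ n, a (8 * n + 4) = a (8 * n + 3) + a (4 * n + 3) - a (4 * n + 2)) ∧
  (∀ n, a (16 * n) = a (8 * n)) ∧
  (∀ n, a (16 * n + 2) = a (8 * n + 2)) ∧
  (∀ n, a (16 * n + 6) = -a (16 * n + 3) + a (8 * n + 3) + 3 * a (8 * n + 2) + a (4 * n + 3)
    - 2 * a (4 * n + 2) - a (2 * n + 1)) ∧
  (∀ n, a (16 * n + 7) = -a (16 * n + 3) + a (8 * n + 3) + 3 * a (8 * n + 2) + 2 * a (4 * n + 3)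
    - 3 * a (4 * n + 2) - a (2 * n + 1)) ∧
  (∀ n, a (16 * n + 8) = a (8 * n + 2) + a (4 * n + 3) - a (2 * n + 1)) ∧
  (∀ n, a (16 * n + 10) = a (8 * n + 2) + a (4 * n + 3) - a (2 * n + 1)) ∧
  (∀ n, a (16 * n + 11) = -a (16 * n + 3) + 3 * a (8 * n + 2) + a (4 * n + 3)
    - 2 * a (2 * n + 1)) ∧
  (∀ n, a (16 * n + 14) = a (16 * n + 3) + a (8 * n + 7) - a (8 * n + 3) - a (8 * n + 2)
    - a (4 * n + 3) + 3 * a (4 * n + 2) - a (2 * n + 1)) ∧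
  (∀ n, a (16 * n + 15) = a (16 * n + 3) + 2 * a (8 * n + 7) - 3 * a (8 * n + 6)
    - 2 * a (8 * n + 3) + 6 * a (4 * n + 2) - 3 * a (2 * n + 1)) ∧
  (∀ n, a (32 * n + 3) = a (8 * n + 3)) ∧
  (∀ n, a (32 * n + 19) = -a (16 * n + 3) + a (8 * n + 3) + 3 * a (8 * n + 2)
    + 2 * a (4 * n + 3) - 3 * a (4 * n + 2) - a (2 * n + 1))

/-- The nine fixed subsequences of `a`. -/
def nine (a : ℕ → ℤ) : Set (ℕ → ℤ) :=
  {subseq a 2 1, subseq a 4 2, subseq a 4 3, subseq a 8 0, subseq a 8 2, subseq a 8 3,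
    subseq a 8 6, subseq a 8 7, subseq a 16 3}

end Regular

end TwoAbelian

namespace TwoAbelian

/-! ### The Thue–Morse word and its doubling rules -/

/-! A 2-abelian class is almost determined by the first letter and the number c of letter changes.
In a factor of length n+1, #01+#10 = c, and #01-#10 is last letter minus first, so the parity of c
gives the last letter. Also #00+#11 = n-c, while #11-#00 is a sum of t_k+t_{k+1}-1. As
t_{2j}+t_{2j+1} = 1, this sum telescopes along a 0/1-valued potential, hence is 0 or ±1: it is 0 if
n+c is even, and otherwise its sign depends on the parity of the position. So c counts once when n+c
is even, and once per position parity realizing it when n+c is odd (`abEquiv_iff_classKey_eq`).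
Complementation makes both first letters equally frequent, whence a factor 2
(`ncard_range_classKey`).

The possible c form an interval. Under doubling, c becomes (window size) - c, so the interval
endpoints for n and n+1 determine those for 2n, 2n+1 and 2n+2 (`ChangeBounds.even`,
`ChangeBounds.odd`). Then `P_odd` and `P_even` express P through floors of halves of endpoints, and
each relation becomes an identity in four endpoints a, b, a', b' with a'-a, b'-b in {0,1}.

For the module, twelve relations make the span of the nine sequences stable under f(2n) and f(2n+1);
the thirteenth, for 8n+4, brings in the one remaining sequence. -/

theorem fin_two_cases (a : Fin 2) : a = 0 ∨ a = 1 := by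
  revert a; decide

theorem tmMorphism_append_singleton (u : List (Fin 2)) (a : Fin 2) :
    tmMorphism (u ++ [a]) = tmMorphism u ++ [a] ++ [1 - a] := by
  rcases fin_two_cases a with rfl | rfl <;> simp [tmMorphism]

theorem tmMorphism_map_range (f : ℕ → Fin 2) (n : ℕ) :
    tmMorphism ((List.range n).map f) =
      (List.range (2 * n)).map fun k => if k % 2 = 0 then f (k / 2) else 1 - f (k / 2) := by
  induction n with
  | zero => rfl
  | succ n ih =>
    have h : (2 * n + 1) / 2 = n := by omega
    rw [show 2 * (n + 1) = 2 * n + 1 + 1 by ring, List.range_succ, List.range_succ,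
      List.range_succ, List.map_append, List.map_append, List.map_append, List.map_singleton,
      tmMorphism_append_singleton, ih]
    simp [h]

theorem thueMorse_eq (k : ℕ) :
    thueMorse k = if k % 2 = 0 then thueMorse (k / 2) else 1 - thueMorse (k / 2) := by
  have h := tmPrefix_succ k
  rw [tmPrefix_eq, tmPrefix_eq, tmMorphism_map_range, pow_succ, mul_comm (2 ^ k) 2] at h
  have hk : k < 2 ^ k := Nat.lt_two_pow_self
  exact List.map_inj_left.mp h k (List.mem_range.mpr (by omega))

/-- The letters of the Thue–Morse word as integers. -/
def tmInt (k : ℕ) : ℤ := ((thueMorse k).val : ℤ)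

theorem tmInt_cases (k : ℕ) : tmInt k = 0 ∨ tmInt k = 1 := by
  unfold tmInt
  rcases fin_two_cases (thueMorse k) with h | h <;> simp [h]

theorem tmInt_inj {i j : ℕ} : tmInt i = tmInt j ↔ thueMorse i = thueMorse j := by
  simp [tmInt, Fin.ext_iff]

theorem tmInt_two_mul (k : ℕ) : tmInt (2 * k) = tmInt k := by
  rw [tmInt_inj, thueMorse_eq]; simp

theorem tmInt_two_mul_add_one (k : ℕ) : tmInt (2 * k + 1) = 1 - tmInt k := by
  have h : thueMorse (2 * k + 1) = 1 - thueMorse k := by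
    rw [thueMorse_eq, if_neg (by omega), show (2 * k + 1) / 2 = k by omega]
  unfold tmInt
  rw [h]
  rcases fin_two_cases (thueMorse k) with h | h <;> simp [h]

/-- The prefix of length 2^q is followed by its complement. -/
theorem tmInt_add_two_pow {q k : ℕ} (h : k < 2 ^ q) : tmInt (k + 2 ^ q) = 1 - tmInt k := by
  induction q generalizing k with
  | zero =>
    obtain rfl : k = 0 := by simpa using h
    exact tmInt_two_mul_add_one 0
  | succ q ih =>
    rw [pow_succ] at h ⊢
    obtain ⟨j, rfl | rfl⟩ := Nat.even_or_odd' k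
    · rw [show 2 * j + 2 ^ q * 2 = 2 * (j + 2 ^ q) by ring, tmInt_two_mul, tmInt_two_mul,
        ih (by omega)]
    · rw [show 2 * j + 1 + 2 ^ q * 2 = 2 * (j + 2 ^ q) + 1 by ring, tmInt_two_mul_add_one,
        tmInt_two_mul_add_one, ih (by omega)]

/-! ### Letter changes in a window -/

/-- The indicator of a letter change between the positions `k` and `k + 1`. -/
def change (k : ℕ) : ℤ := if tmInt k = tmInt (k + 1) then 0 else 1

theorem change_cases (k : ℕ) : change k = 0 ∨ change k = 1 := by
  unfold change; split_ifs <;> simp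

theorem change_two_mul (k : ℕ) : change (2 * k) = 1 := by
  unfold change
  rw [tmInt_two_mul, tmInt_two_mul_add_one]
  rcases tmInt_cases k with h | h <;> simp [h]

theorem change_two_mul_add_one (k : ℕ) : change (2 * k + 1) = 1 - change k := by
  unfold change
  rw [show 2 * k + 1 + 1 = 2 * (k + 1) by ring, tmInt_two_mul, tmInt_two_mul_add_one]
  rcases tmInt_cases k with h | h <;> rcases tmInt_cases (k + 1) with h' | h' <;> simp [h, h']

/-- The number of letter changes in the factor of length `n + 1` at position `i`. -/
def changes (i n : ℕ) : ℤ := ∑ k ∈ Finset.range n, change (i + k)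

@[simp] theorem changes_zero (i : ℕ) : changes i 0 = 0 := rfl

theorem changes_succ (i n : ℕ) : changes i (n + 1) = changes i n + change (i + n) :=
  Finset.sum_range_succ _ _

/-- Inside a block m(x) there is always a change; between m(x) and m(y) there is one exactly when x
= y. Hence each change upstairs removes one change below. -/
theorem changes_even_even (j n : ℕ) : changes (2 * j) (2 * n) = 2 * n - changes j n := by
  induction n with
  | zero => simp
  | succ n ih =>
    rw [show 2 * (n + 1) = 2 * n + 1 + 1 by ring, changes_succ, changes_succ, changes_succ, ih,
      show 2 * j + 2 * n = 2 * (j + n) by ring, show 2 * j + (2 * n + 1) = 2 * (j + n) + 1 by ring,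
      change_two_mul, change_two_mul_add_one]
    push_cast; ring

theorem changes_odd_even (j n : ℕ) : changes (2 * j + 1) (2 * n) = 2 * n - changes j n := by
  induction n with
  | zero => simp
  | succ n ih =>
    rw [show 2 * (n + 1) = 2 * n + 1 + 1 by ring, changes_succ, changes_succ, changes_succ, ih,
      show 2 * j + 1 + 2 * n = 2 * (j + n) + 1 by ring,
      show 2 * j + 1 + (2 * n + 1) = 2 * (j + n + 1) by ring,
      change_two_mul, change_two_mul_add_one]
    push_cast; ring

theorem changes_even_odd (j n : ℕ) :
    changes (2 * j) (2 * n + 1) = 2 * n + 1 - changes j n := by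
  rw [changes_succ, changes_even_even, show 2 * j + 2 * n = 2 * (j + n) by ring, change_two_mul]
  ring

/-- Starting and ending at block boundaries, the window meets n+1 of them, hence n+1 steps of the
preimage; this is why lengths n and n+1 must be tracked together. -/
theorem changes_odd_odd (j n : ℕ) :
    changes (2 * j + 1) (2 * n + 1) = 2 * n + 1 - changes j (n + 1) := by
  rw [changes_succ, changes_odd_even, show 2 * j + 1 + 2 * n = 2 * (j + n) + 1 by ring,
    change_two_mul_add_one, changes_succ]
  ring

/-- The numbers of letter changes in the factors of lengths `n + 1` and `n + 2` fill the intervals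
`[a, b]` and `[a', b']`, whose endpoints move up by at most one. -/
structure ChangeBounds (n : ℕ) (a b a' b' : ℤ) : Prop where
  mem : ∀ k, (∃ i, changes i n = k) ↔ a ≤ k ∧ k ≤ b
  mem' : ∀ k, (∃ i, changes i (n + 1) = k) ↔ a' ≤ k ∧ k ≤ b'
  le : a ≤ b
  le' : a' ≤ b'
  lower_le : a ≤ a'
  lower_le' : a' ≤ a + 1
  upper_le : b ≤ b'
  upper_le' : b' ≤ b + 1

namespace ChangeBounds

variable {n : ℕ} {a b a' b' : ℤ}

theorem changes_mem (h : ChangeBounds n a b a' b') (i : ℕ) :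
    a ≤ changes i n ∧ changes i n ≤ b := (h.mem _).1 ⟨i, rfl⟩

theorem changes_mem' (h : ChangeBounds n a b a' b') (i : ℕ) :
    a' ≤ changes i (n + 1) ∧ changes i (n + 1) ≤ b' := (h.mem' _).1 ⟨i, rfl⟩

theorem mem_two_mul (h : ChangeBounds n a b a' b') (k : ℤ) :
    (∃ i, changes i (2 * n) = k) ↔ 2 * n - b ≤ k ∧ k ≤ 2 * n - a := by
  constructor
  · rintro ⟨i, rfl⟩
    obtain ⟨j, rfl | rfl⟩ := Nat.even_or_odd' i
    · have := h.changes_mem j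
      rw [changes_even_even]; omega
    · have := h.changes_mem j
      rw [changes_odd_even]; omega
  · rintro ⟨h1, h2⟩
    obtain ⟨j, hj⟩ := (h.mem (2 * n - k)).2 ⟨by omega, by omega⟩
    exact ⟨2 * j, by rw [changes_even_even]; omega⟩

theorem mem_two_mul_add_one (h : ChangeBounds n a b a' b') (k : ℤ) :
    (∃ i, changes i (2 * n + 1) = k) ↔ 2 * n + 1 - b' ≤ k ∧ k ≤ 2 * n + 1 - a := by
  obtain ⟨-, -, h1, h2, h3, h4, h5, h6⟩ := id h
  constructor
  · rintro ⟨i, rfl⟩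
    obtain ⟨j, rfl | rfl⟩ := Nat.even_or_odd' i
    · have := h.changes_mem j
      rw [changes_even_odd]; omega
    · have := h.changes_mem' j
      rw [changes_odd_odd]; omega
  · rintro ⟨h7, h8⟩
    -- Even positions supply [a, b] and odd ones [a', b']; since a' ≤ a+1 ≤ b+1, the union has no
    -- gap and equals [a, b'].
    by_cases hk : 2 * n + 1 - k ≤ b
    · obtain ⟨j, hj⟩ := (h.mem (2 * n + 1 - k)).2 ⟨by omega, hk⟩
      exact ⟨2 * j, by rw [changes_even_odd]; omega⟩
    · obtain ⟨j, hj⟩ := (h.mem' (2 * n + 1 - k)).2 ⟨by omega, by omega⟩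
      exact ⟨2 * j + 1, by rw [changes_odd_odd]; omega⟩

theorem zero : ChangeBounds 0 0 0 0 1 where
  mem k := by simp [le_antisymm_iff, and_comm]
  mem' k := by
    constructor
    · rintro ⟨i, rfl⟩
      rw [changes_succ, changes_zero]
      rcases change_cases (i + 0) with h | h <;> omega
    · intro h
      obtain rfl | rfl : k = 0 ∨ k = 1 := by omega
      · refine ⟨1, ?_⟩
        rw [changes_succ, changes_zero, show 1 + 0 = 2 * 0 + 1 by rfl, change_two_mul_add_one,
          show change 0 = 1 from change_two_mul 0]
        rfl
      · refine ⟨0, ?_⟩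
        rw [changes_succ, changes_zero, show 0 + 0 = 2 * 0 by rfl, change_two_mul]
        rfl
  le := by norm_num
  le' := by norm_num
  lower_le := by norm_num
  lower_le' := by norm_num
  upper_le := by norm_num
  upper_le' := by norm_num

theorem even (h : ChangeBounds n a b a' b') :
    ChangeBounds (2 * n) (2 * n - b) (2 * n - a) (2 * n + 1 - b') (2 * n + 1 - a) := by
  obtain ⟨-, -, h1, h2, h3, h4, h5, h6⟩ := id h
  exact ⟨h.mem_two_mul, h.mem_two_mul_add_one,
    by omega, by omega, by omega, by omega, by omega, by omega⟩

theorem succ_mem_two_mul (h : ChangeBounds n a b a' b') (k : ℤ) :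
    (∃ i, changes i (2 * n + 1 + 1) = k) ↔ 2 * n + 2 - b' ≤ k ∧ k ≤ 2 * n + 2 - a' := by
  rw [show 2 * n + 1 + 1 = 2 * (n + 1) by ring]
  constructor
  · rintro ⟨i, rfl⟩
    obtain ⟨j, rfl | rfl⟩ := Nat.even_or_odd' i
    · have := h.changes_mem' j
      rw [changes_even_even]; push_cast; omega
    · have := h.changes_mem' j
      rw [changes_odd_even]; push_cast; omega
  · rintro ⟨h1, h2⟩
    obtain ⟨j, hj⟩ := (h.mem' (2 * n + 2 - k)).2 ⟨by omega, by omega⟩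
    exact ⟨2 * j, by rw [changes_even_even]; push_cast; omega⟩

theorem odd (h : ChangeBounds n a b a' b') :
    ChangeBounds (2 * n + 1) (2 * n + 1 - b') (2 * n + 1 - a) (2 * n + 2 - b')
      (2 * n + 2 - a') := by
  obtain ⟨-, -, h1, h2, h3, h4, h5, h6⟩ := id h
  exact ⟨h.mem_two_mul_add_one, h.succ_mem_two_mul,
    by omega, by omega, by omega, by omega, by omega, by omega⟩

end ChangeBounds

theorem exists_changeBounds (n : ℕ) : ∃ a b a' b', ChangeBounds n a b a' b' := by
  induction n using Nat.strong_induction_on with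
  | _ n ih =>
    obtain ⟨m, rfl | rfl⟩ := Nat.even_or_odd' n
    · rcases Nat.eq_zero_or_pos m with rfl | hm
      · exact ⟨0, 0, 0, 1, ChangeBounds.zero⟩
      · obtain ⟨a, b, a', b', h⟩ := ih m (by omega)
        exact ⟨_, _, _, _, h.even⟩
    · obtain ⟨a, b, a', b', h⟩ := ih m (by omega)
      exact ⟨_, _, _, _, h.odd⟩

/-! ### Classes of factors -/

/-- The factor of length `n` of the Thue–Morse word at position `i`. -/
def tmFactor (i n : ℕ) : List (Fin 2) := (List.range n).map fun k => thueMorse (i + k)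

theorem tmFactor_succ (i n : ℕ) :
    tmFactor i (n + 1) = thueMorse i :: tmFactor (i + 1) n := by
  unfold tmFactor
  rw [List.range_succ_eq_map, List.map_cons, List.map_map]
  refine congrArg _ (List.map_congr_left fun k _ => ?_)
  simp [Function.comp, Nat.add_assoc, Nat.add_comm 1 k]

theorem tmFactor_succ' (i n : ℕ) :
    tmFactor i (n + 1) = tmFactor i n ++ [thueMorse (i + n)] := by
  simp [tmFactor, List.range_succ]

theorem length_tmFactor (i n : ℕ) : (tmFactor i n).length = n := by simp [tmFactor]

theorem pref_tmFactor (i n : ℕ) : pref (2 - 1) (tmFactor i (n + 1)) = [thueMorse i] := by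
  rw [tmFactor_succ]; simp [pref]

theorem suff_tmFactor (i n : ℕ) :
    suff (2 - 1) (tmFactor i (n + 1)) = [thueMorse (i + n)] := by
  rw [suff, length_tmFactor, tmFactor_succ']
  exact List.drop_left' (by simp [length_tmFactor])

/-- The number of occurrences of the word `xy` in the factor of length `n + 1` at position `i`. -/
def pairCount (x y : Fin 2) (i n : ℕ) : ℕ :=
  ∑ k ∈ Finset.range n, if thueMorse (i + k) = x ∧ thueMorse (i + k + 1) = y then 1 else 0

theorem pairCount_succ (x y : Fin 2) (i n : ℕ) :
    pairCount x y i (n + 1) = pairCount x y i n +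
      if thueMorse (i + n) = x ∧ thueMorse (i + n + 1) = y then 1 else 0 :=
  Finset.sum_range_succ _ _

theorem occ_pair_tmFactor (x y : Fin 2) (i n : ℕ) :
    occ [x, y] (tmFactor i (n + 1)) = pairCount x y i n := by
  induction n generalizing i with
  | zero => simp [tmFactor, occ, pairCount]
  | succ n ih =>
    have h : pairCount x y i (n + 1) = pairCount x y (i + 1) n +
        if thueMorse i = x ∧ thueMorse (i + 1) = y then 1 else 0 := by
      unfold pairCount
      rw [Finset.sum_range_succ']
      simp [Nat.add_assoc, Nat.add_comm 1]
    rw [h, ← ih, tmFactor_succ, occ, List.tails, List.countP_cons, occ]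
    congr 1
    rw [tmFactor_succ]
    simp only [List.cons_prefix_cons, List.nil_prefix, and_true, decide_eq_true_eq,
      @eq_comm _ x, @eq_comm _ y]

/-- A potential whose increments are the letter sums `t_k + t_{k+1} - 1`. -/
def potential (k : ℕ) : ℤ := if k % 2 = 0 then tmInt k else 1 - tmInt k

theorem potential_succ (k : ℕ) :
    potential (k + 1) = potential k + tmInt k + tmInt (k + 1) - 1 := by
  unfold potential
  obtain ⟨j, rfl | rfl⟩ := Nat.even_or_odd' k
  · have h := tmInt_two_mul j
    have h' := tmInt_two_mul_add_one j
    rw [if_neg (by omega), if_pos (by omega)]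
    omega
  · rw [if_pos (by omega), if_neg (by omega)]
    omega

/-- If n plus the letter difference is even, both increments vanish; otherwise equal position
parities make them agree term by term. -/
theorem potential_sub_eq {i j n : ℕ} (h : tmInt i = tmInt j)
    (h' : tmInt (i + n) = tmInt (j + n))
    (hpar : (n + (tmInt (i + n) - tmInt i)) % 2 = 0 ∨ i % 2 = j % 2) :
    potential (i + n) - potential i = potential (j + n) - potential j := by
  simp only [potential, ← h, ← h']
  rcases hpar with hpar | hpar
  · rcases tmInt_cases i with ti | ti <;> rcases tmInt_cases (i + n) with ti' | ti' <;>
      rw [ti, ti'] at hpar ⊢ <;> clear h h' ti ti' <;> split_ifs <;> omega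
  · rw [hpar, show (i + n) % 2 = (j + n) % 2 by omega]

/-- The four counts are recovered from their sums (n-c and c) and their differences, which
telescope. -/
theorem pairCount_cast (i n : ℕ) :
    2 * (pairCount 1 1 i n : ℤ) = n - changes i n + (potential (i + n) - potential i) ∧
    2 * (pairCount 0 0 i n : ℤ) = n - changes i n - (potential (i + n) - potential i) ∧
    2 * (pairCount 0 1 i n : ℤ) = changes i n + (tmInt (i + n) - tmInt i) ∧
    2 * (pairCount 1 0 i n : ℤ) = changes i n - (tmInt (i + n) - tmInt i) := by
  induction n with
  | zero => simp [pairCount]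
  | succ n ih =>
    have hp := potential_succ (i + n)
    simp only [pairCount_succ, changes_succ, ← Nat.add_assoc, change]
    unfold tmInt at hp ih ⊢
    generalize potential (i + n + 1) = p' at *
    generalize potential (i + n) = p at *
    rcases fin_two_cases (thueMorse (i + n)) with h | h <;>
      rcases fin_two_cases (thueMorse (i + n + 1)) with h' | h' <;>
      simp [h, h'] at hp ih ⊢ <;> omega

theorem abEquiv_tmFactor_iff (i j n : ℕ) :
    AbEquiv 2 (tmFactor i (n + 1)) (tmFactor j (n + 1)) ↔
      (thueMorse i = thueMorse j ∧ thueMorse (i + n) = thueMorse (j + n)) ∧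
        ∀ x y, pairCount x y i n = pairCount x y j n := by
  unfold AbEquiv
  rw [pref_tmFactor, pref_tmFactor, suff_tmFactor, suff_tmFactor, List.singleton_inj,
    List.singleton_inj]
  refine and_congr_right fun _ => ⟨fun h x y => ?_, fun h w hw => ?_⟩
  · simpa [occ_pair_tmFactor] using h [x, y] rfl
  · obtain ⟨x, y, rfl⟩ := List.length_eq_two.1 hw
    rw [occ_pair_tmFactor, occ_pair_tmFactor, h]

/-- A complete invariant of the 2-abelian class of the factor of length `n + 1` at position `i`:
the first letter, the number of letter changes, and the parity of the position when the length
and the number of letter changes have the same parity. -/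
def classKey (n i : ℕ) : Fin 2 × ℤ × ℤ :=
  (thueMorse i, changes i n, if (n + changes i n) % 2 = 0 then 0 else i % 2)

theorem abEquiv_iff_classKey_eq (i j n : ℕ) :
    AbEquiv 2 (tmFactor i (n + 1)) (tmFactor j (n + 1)) ↔ classKey n i = classKey n j := by
  obtain ⟨i1, i2, i3, i4⟩ := pairCount_cast i n
  obtain ⟨j1, j2, j3, j4⟩ := pairCount_cast j n
  have ti := tmInt_cases i
  have ti' := tmInt_cases (i + n)
  have tj := tmInt_cases j
  have tj' := tmInt_cases (j + n)
  simp only [abEquiv_tmFactor_iff, classKey, Prod.mk.injEq, ← tmInt_inj]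
  constructor
  · rintro ⟨⟨h1, h2⟩, h3⟩
    have c11 := h3 1 1
    have c00 := h3 0 0
    have c01 := h3 0 1
    have c10 := h3 1 0
    have hc : changes i n = changes j n := by omega
    refine ⟨h1, hc, ?_⟩
    rw [← hc]
    split_ifs
    · rfl
    -- Now n+c is odd, so the potential increment is ±1 and, for fixed end letters, changes sign
    -- with the parity of the position.
    · simp only [potential] at i1 i2 j1 j2
      split_ifs at i1 i2 j1 j2 <;> omega
  · rintro ⟨h1, h2, h3⟩
    have h4 : tmInt (i + n) = tmInt (j + n) := by omega
    refine ⟨⟨h1, h4⟩, fun x y => ?_⟩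
    have c01 : pairCount 0 1 i n = pairCount 0 1 j n := by omega
    have c10 : pairCount 1 0 i n = pairCount 1 0 j n := by omega
    have c : pairCount 1 1 i n = pairCount 1 1 j n ∧ pairCount 0 0 i n = pairCount 0 0 j n := by
      have hpot := potential_sub_eq h1 h4 (by
        rw [← h2] at h3
        split_ifs at h3 with h
        · left; omega
        · right; omega)
      omega
    rcases fin_two_cases x with rfl | rfl <;> rcases fin_two_cases y with rfl | rfl
    exacts [c.2, c01, c10, c.1]

theorem card_quotient_eq_ncard_range {X Y : Type*} (s : Setoid X) (p : ℕ → X)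
    (hp : Function.Surjective p) (f : ℕ → Y) (h : ∀ i j, s.r (p i) (p j) ↔ f i = f j) :
    Nat.card (Quotient s) = (Set.range f).ncard := by
  rw [← Nat.card_coe_set_eq]
  symm
  refine Nat.card_congr (Equiv.ofBijective
    (fun y : Set.range f => (Quotient.mk s (p y.2.choose))) ⟨?_, ?_⟩)
  · intro y z hyz
    have := (h _ _).1 (Quotient.exact hyz)
    rwa [y.2.choose_spec, z.2.choose_spec, ← Subtype.ext_iff] at this
  · intro q
    obtain ⟨x, rfl⟩ := Quotient.exists_rep q
    obtain ⟨i, rfl⟩ := hp x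
    exact ⟨⟨f i, i, rfl⟩,
      Quotient.sound ((h _ _).2 (Exists.choose_spec (p := fun k => f k = f i) _))⟩

theorem P_succ_eq_ncard (n : ℕ) : P (n + 1) = (Set.range (classKey n)).ncard := by
  unfold P abComplexity
  rw [card_quotient_eq_ncard_range (abSetoid 2 thueMorse (n + 1))
    (fun i => ⟨tmFactor i (n + 1), i, rfl⟩) ?_ (classKey n)
    fun i j => abEquiv_iff_classKey_eq i j n]
  rintro ⟨u, i, rfl⟩
  exact ⟨i, rfl⟩

/-! ### Counting the classes -/

/-- A shift by a large even power of two complements the window, keeping its changes and the parity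
of its position. -/
theorem exists_complement (x : Fin 2) (i n : ℕ) :
    ∃ j, thueMorse j = x ∧ changes j n = changes i n ∧ j % 2 = i % 2 := by
  by_cases h : thueMorse i = x
  · exact ⟨i, h, rfl, rfl⟩
  · have hq : ∀ k ≤ n, tmInt (i + 2 ^ (i + n + 1) + k) = 1 - tmInt (i + k) := fun k hk => by
      have : i + n + 1 < 2 ^ (i + n + 1) := Nat.lt_two_pow_self
      rw [show i + 2 ^ (i + n + 1) + k = i + k + 2 ^ (i + n + 1) by ring,
        tmInt_add_two_pow (by omega)]
    refine ⟨i + 2 ^ (i + n + 1), ?_, Finset.sum_congr rfl fun k hk => ?_, ?_⟩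
    · have h0 := hq 0 (Nat.zero_le _)
      unfold tmInt at h0
      rcases fin_two_cases (thueMorse i) with hi | hi <;> rcases fin_two_cases x with rfl | rfl <;>
        simp_all
      all_goals omega
    · have hk' := Finset.mem_range.1 hk
      have h1 := hq k hk'.le
      have h2 := hq (k + 1) hk'
      simp only [change, Nat.add_assoc] at *
      rw [h1, h2]
      simp
    · rw [pow_succ]; omega

/-- The integers of `[a, b]` congruent to `r` modulo 2. -/
noncomputable def parityIcc (r a b : ℤ) : Finset ℤ := (Finset.Icc a b).filter fun k => k % 2 = r

theorem mem_parityIcc {r a b k : ℤ} : k ∈ parityIcc r a b ↔ (a ≤ k ∧ k ≤ b) ∧ k % 2 = r := by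
  simp [parityIcc]

theorem card_parityIcc_zero {a b : ℤ} (h : a ≤ b) :
    ((parityIcc 0 a b).card : ℤ) = b / 2 + 1 - (a + 1) / 2 := by
  have e : parityIcc 0 a b = (Finset.Icc ((a + 1) / 2) (b / 2)).image fun k => 2 * k := by
    ext k
    simp only [mem_parityIcc, Finset.mem_image, Finset.mem_Icc]
    constructor
    · intro h
      exact ⟨k / 2, by omega, by omega⟩
    · rintro ⟨j, hj, rfl⟩
      omega
  rw [e, Finset.card_image_of_injective _ fun x y h => by simpa using h, Int.card_Icc]
  omega

theorem card_parityIcc_one {a b : ℤ} (h : a ≤ b) :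
    ((parityIcc 1 a b).card : ℤ) = (b + 1) / 2 - a / 2 := by
  have e : parityIcc 1 a b = (Finset.Icc (a / 2) ((b + 1) / 2 - 1)).image fun k => 2 * k + 1 := by
    ext k
    simp only [mem_parityIcc, Finset.mem_image, Finset.mem_Icc]
    constructor
    · intro h
      exact ⟨k / 2, by omega, by omega⟩
    · rintro ⟨j, hj, rfl⟩
      omega
  rw [e, Finset.card_image_of_injective _ fun x y h => by simpa using h, Int.card_Icc]
  omega

theorem ncard_range_classKey (n : ℕ) (S S₀ S₁ : Finset ℤ)
    (hS : ∀ k, k ∈ S ↔ (∃ i, changes i n = k) ∧ (n + k) % 2 = 0)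
    (hS₀ : ∀ k, k ∈ S₀ ↔ (∃ i, changes (2 * i) n = k) ∧ (n + k) % 2 = 1)
    (hS₁ : ∀ k, k ∈ S₁ ↔ (∃ i, changes (2 * i + 1) n = k) ∧ (n + k) % 2 = 1) :
    (Set.range (classKey n)).ncard = 2 * (S.card + S₀.card + S₁.card) := by
  -- Label 0 carries both `S` and `S₀`, which the parity of n+k keeps apart; label 1 carries only
  -- `S₁`.
  have e : Set.range (classKey n) =
      ↑((Finset.univ : Finset (Fin 2)) ×ˢ ((S.disjUnion S₀ (Finset.disjoint_left.2 fun k h h' => by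
        have := (hS k).1 h
        have := (hS₀ k).1 h'
        omega)) ×ˢ {(0 : ℤ)} ∪ S₁ ×ˢ {(1 : ℤ)})) := by
    ext ⟨x, k, z⟩
    simp only [Set.mem_range, classKey, Prod.mk.injEq, Finset.mem_coe, Finset.mem_product,
      Finset.mem_univ, true_and, Finset.mem_union, Finset.mem_singleton, Finset.mem_disjUnion,
      hS, hS₀, hS₁]
    constructor
    · rintro ⟨i, -, rfl, rfl⟩
      split_ifs with h
      · exact Or.inl ⟨Or.inl ⟨⟨i, rfl⟩, h⟩, rfl⟩
      · obtain ⟨j, rfl | rfl⟩ := Nat.even_or_odd' i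
        · exact Or.inl ⟨Or.inr ⟨⟨j, rfl⟩, by omega⟩, by omega⟩
        · exact Or.inr ⟨⟨⟨j, rfl⟩, by omega⟩, by omega⟩
    · rintro (⟨⟨⟨i, rfl⟩, h⟩ | ⟨⟨i, rfl⟩, h⟩, rfl⟩ | ⟨⟨⟨i, rfl⟩, h⟩, rfl⟩)
      · obtain ⟨j, h1, h2, -⟩ := exists_complement x i n
        exact ⟨j, h1, h2, by rw [h2, if_pos h]⟩
      · obtain ⟨j, h1, h2, h3⟩ := exists_complement x (2 * i) n
        exact ⟨j, h1, h2, by rw [h2, if_neg (by omega)]; omega⟩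
      · obtain ⟨j, h1, h2, h3⟩ := exists_complement x (2 * i + 1) n
        exact ⟨j, h1, h2, by rw [h2, if_neg (by omega)]; omega⟩
  rw [e, Set.ncard_coe_finset, Finset.card_product, Finset.card_union_of_disjoint,
    Finset.card_product, Finset.card_product, Finset.card_disjUnion]
  · simp
  · rw [Finset.disjoint_left]
    rintro ⟨k, z⟩ h h'
    simp only [Finset.mem_product, Finset.mem_singleton] at h h'
    omega

namespace ChangeBounds

variable {n : ℕ} {a b a' b' : ℤ}

/-- Positions of either parity realize the whole interval, so odd values count twice. -/
theorem P_odd (h : ChangeBounds n a b a' b') {m : ℕ} (hm : m = 2 * n + 1) :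
    P m = 2 * ((b / 2 + 1 - (a + 1) / 2) + 2 * ((b + 1) / 2 - a / 2)) := by
  have hle := h.le
  have key : ∀ k, (∃ i, changes i n = 2 * n - k) ↔ 2 * n - b ≤ k ∧ k ≤ 2 * n - a := fun k => by
    rw [h.mem]; omega
  rw [hm, P_succ_eq_ncard, ncard_range_classKey (2 * n) (parityIcc 0 (2 * n - b) (2 * n - a))
    (parityIcc 1 (2 * n - b) (2 * n - a)) (parityIcc 1 (2 * n - b) (2 * n - a))]
  · push_cast
    rw [card_parityIcc_zero (by omega), card_parityIcc_one (by omega)]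
    omega
  · intro k
    rw [mem_parityIcc, h.mem_two_mul]
    push_cast; omega
  · intro k
    have e : ∀ i, changes (2 * i) (2 * n) = k ↔ changes i n = 2 * n - k := fun i => by
      rw [changes_even_even]; omega
    simp only [mem_parityIcc, e, key]
    push_cast; omega
  · intro k
    have e : ∀ i, changes (2 * i + 1) (2 * n) = k ↔ changes i n = 2 * n - k := fun i => by
      rw [changes_odd_even]; omega
    simp only [mem_parityIcc, e, key]
    push_cast; omega

/-- The two position parities realize different intervals, [a, b] and [a', b'] after the reflection
k ↦ 2n+1-k, which also swaps parities. -/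
theorem P_even (h : ChangeBounds n a b a' b') {m : ℕ} (hm : m = 2 * n + 2) :
    P m = 2 * ((b' / 2 + 1 - (a + 1) / 2) + ((b + 1) / 2 - a / 2) +
      ((b' + 1) / 2 - a' / 2)) := by
  obtain ⟨-, -, h1, h2, h3, h4, h5, h6⟩ := id h
  rw [hm, P_succ_eq_ncard,
    ncard_range_classKey (2 * n + 1) (parityIcc 1 (2 * n + 1 - b') (2 * n + 1 - a))
    (parityIcc 0 (2 * n + 1 - b) (2 * n + 1 - a)) (parityIcc 0 (2 * n + 1 - b') (2 * n + 1 - a'))]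
  · push_cast
    rw [card_parityIcc_zero (by omega), card_parityIcc_zero (by omega),
      card_parityIcc_one (by omega)]
    omega
  · intro k
    rw [mem_parityIcc, h.mem_two_mul_add_one]
    push_cast; omega
  · intro k
    have e : ∀ i, changes (2 * i) (2 * n + 1) = k ↔ changes i n = 2 * n + 1 - k := fun i => by
      rw [changes_even_odd]; omega
    simp only [mem_parityIcc, e, h.mem]
    push_cast; omega
  · intro k
    have e : ∀ i, changes (2 * i + 1) (2 * n + 1) = k ↔ changes i (n + 1) = 2 * n + 1 - k :=
      fun i => by rw [changes_odd_odd]; omega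
    simp only [mem_parityIcc, e, h.mem']
    push_cast; omega

end ChangeBounds

/-! ### The relations -/

set_option maxHeartbeats 2000000 in
theorem relations_P : Relations P := by
  refine ⟨fun n => ?_, fun n => ?_, fun n => ?_, fun n => ?_, fun n => ?_, fun n => ?_,
    fun n => ?_, fun n => ?_, fun n => ?_, fun n => ?_, fun n => ?_, fun n => ?_, fun n => ?_⟩
  -- The counting formulas cover positive lengths only. For n+1 in place of n, the lengths are
  -- 2(8n+7)+2 and 2(4n+3)+2.
  case refine_3 =>
    obtain _ | n := n
    · rfl
    obtain ⟨a, b, a', b', h⟩ := exists_changeBounds n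
    have := h.lower_le
    have := h.lower_le'
    have := h.upper_le
    have := h.upper_le'
    rw [h.odd.odd.odd.P_even (by ring), h.odd.odd.P_even (by ring)]
    push_cast
    omega
  all_goals
    obtain ⟨a, b, a', b', h⟩ := exists_changeBounds n
    have := h.lower_le
    have := h.lower_le'
    have := h.upper_le
    have := h.upper_le'
    have p21 := h.P_odd rfl
    have p42 := h.even.P_even (m := 4 * n + 2) (by ring)
    have p43 := h.odd.P_odd (m := 4 * n + 3) (by ring)
    have p82 := h.even.even.P_even (m := 8 * n + 2) (by ring)
    have p83 := h.even.odd.P_odd (m := 8 * n + 3) (by ring)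
    have p163 := h.even.even.odd.P_odd (m := 16 * n + 3) (by ring)
    push_cast at *
  · rw [h.even.P_odd (by ring)]; omega
  · rw [h.even.odd.P_even (by ring)]; push_cast; omega
  · rw [h.even.even.even.P_even (by ring)]; push_cast; omega
  · rw [h.even.odd.even.P_even (by ring)]; push_cast; omega
  · rw [h.even.odd.odd.P_odd (by ring)]; push_cast; omega
  · rw [h.even.odd.odd.P_even (by ring)]
    obtain rfl | rfl : a' = a ∨ a' = a + 1 := by omega
    all_goals obtain rfl | rfl : b' = b ∨ b' = b + 1 := by omega
    all_goals push_cast; omega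
  · rw [h.odd.even.even.P_even (by ring)]; push_cast; omega
  · rw [h.odd.even.odd.P_odd (by ring)]; push_cast; omega
  · have := h.odd.odd.P_odd (m := 8 * n + 7) (by ring)
    rw [h.odd.odd.even.P_even (by ring)]; push_cast at *; omega
  · have := h.odd.odd.P_odd (m := 8 * n + 7) (by ring)
    have := h.odd.even.P_even (m := 8 * n + 6) (by ring)
    rw [h.odd.odd.odd.P_odd (by ring)]; push_cast at *; omega
  · rw [h.even.even.even.odd.P_odd (by ring)]; push_cast; omega
  · rw [h.odd.even.even.odd.P_odd (by ring)]; push_cast; omega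

/-! ### The module generated by the kernel -/

/-- Of the eighteen even and odd sections of the nine generators, six are generators again and
twelve are given by relations. -/
theorem subseq_bit_mem_span {a : ℕ → ℤ} (h : Relations a) (r : ℕ) (hr : r < 2) {f : ℕ → ℤ}
    (hf : f ∈ Submodule.span ℤ (nine a)) : subseq f 2 r ∈ Submodule.span ℤ (nine a) := by
  obtain ⟨h1, h2, h3, h4, h5, h6, h7, h8, h9, h10, h11, h12, h13⟩ := h
  have g21 : subseq a 2 1 ∈ Submodule.span ℤ (nine a) := Submodule.subset_span (by simp [nine])
  have g42 : subseq a 4 2 ∈ Submodule.span ℤ (nine a) := Submodule.subset_span (by simp [nine])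
  have g43 : subseq a 4 3 ∈ Submodule.span ℤ (nine a) := Submodule.subset_span (by simp [nine])
  have g80 : subseq a 8 0 ∈ Submodule.span ℤ (nine a) := Submodule.subset_span (by simp [nine])
  have g82 : subseq a 8 2 ∈ Submodule.span ℤ (nine a) := Submodule.subset_span (by simp [nine])
  have g83 : subseq a 8 3 ∈ Submodule.span ℤ (nine a) := Submodule.subset_span (by simp [nine])
  have g86 : subseq a 8 6 ∈ Submodule.span ℤ (nine a) := Submodule.subset_span (by simp [nine])
  have g87 : subseq a 8 7 ∈ Submodule.span ℤ (nine a) := Submodule.subset_span (by simp [nine])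
  have g163 : subseq a 16 3 ∈ Submodule.span ℤ (nine a) := Submodule.subset_span (by simp [nine])
  have hsub : ∀ p c, subseq (subseq a p c) 2 r = subseq a (2 * p) (p * r + c) := fun p c => by
    funext n; simp only [subseq]; congr 1; ring
  induction hf using Submodule.span_induction with
  | zero => exact Submodule.zero_mem _
  | add x y _ _ hx hy => exact Submodule.add_mem _ hx hy
  | smul c x _ hx => exact Submodule.smul_mem _ c hx
  | mem x hx =>
    simp only [nine, Set.mem_insert_iff, Set.mem_singleton_iff] at hx
    obtain rfl | rfl : r = 0 ∨ r = 1 := by omega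
    · rcases hx with rfl | rfl | rfl | rfl | rfl | rfl | rfl | rfl | rfl <;>
        rw [hsub] <;> norm_num only
      · rwa [show subseq a 4 1 = subseq a 2 1 from funext h1]
      · exact g82
      · exact g83
      · rwa [show subseq a 16 0 = subseq a 8 0 from funext h3]
      · rwa [show subseq a 16 2 = subseq a 8 2 from funext h4]
      · exact g163
      · rw [show subseq a 16 6 = -subseq a 16 3 + subseq a 8 3 + (3 : ℤ) • subseq a 8 2
          + subseq a 4 3 - (2 : ℤ) • subseq a 4 2 - subseq a 2 1 from funext h5]
        repeat' first | assumption | apply add_mem | apply sub_mem | apply neg_mem | apply zsmul_mem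
      · rw [show subseq a 16 7 = -subseq a 16 3 + subseq a 8 3 + (3 : ℤ) • subseq a 8 2
          + (2 : ℤ) • subseq a 4 3 - (3 : ℤ) • subseq a 4 2 - subseq a 2 1 from funext h6]
        repeat' first | assumption | apply add_mem | apply sub_mem | apply neg_mem | apply zsmul_mem
      · rwa [show subseq a 32 3 = subseq a 8 3 from funext h12]
    · rcases hx with rfl | rfl | rfl | rfl | rfl | rfl | rfl | rfl | rfl <;>
        rw [hsub] <;> norm_num only
      · exact g43
      · exact g86
      · exact g87
      · rw [show subseq a 16 8 = subseq a 8 2 + subseq a 4 3 - subseq a 2 1 from funext h7]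
        exact sub_mem (add_mem g82 g43) g21
      · rw [show subseq a 16 10 = subseq a 8 2 + subseq a 4 3 - subseq a 2 1 from funext h8]
        exact sub_mem (add_mem g82 g43) g21
      · rw [show subseq a 16 11 = -subseq a 16 3 + (3 : ℤ) • subseq a 8 2 + subseq a 4 3
          - (2 : ℤ) • subseq a 2 1 from funext h9]
        repeat' first | assumption | apply add_mem | apply sub_mem | apply neg_mem | apply zsmul_mem
      · rw [show subseq a 16 14 = subseq a 16 3 + subseq a 8 7 - subseq a 8 3 - subseq a 8 2
          - subseq a 4 3 + (3 : ℤ) • subseq a 4 2 - subseq a 2 1 from funext h10]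
        repeat' first | assumption | apply add_mem | apply sub_mem | apply neg_mem | apply zsmul_mem
      · rw [show subseq a 16 15 = subseq a 16 3 + (2 : ℤ) • subseq a 8 7
          - (3 : ℤ) • subseq a 8 6 - (2 : ℤ) • subseq a 8 3 + (6 : ℤ) • subseq a 4 2
          - (3 : ℤ) • subseq a 2 1 from funext h11]
        repeat' first | assumption | apply add_mem | apply sub_mem | apply neg_mem | apply zsmul_mem
      · rw [show subseq a 32 19 = -subseq a 16 3 + subseq a 8 3 + (3 : ℤ) • subseq a 8 2
          + (2 : ℤ) • subseq a 4 3 - (3 : ℤ) • subseq a 4 2 - subseq a 2 1 from funext h13]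
        repeat' first | assumption | apply add_mem | apply sub_mem | apply neg_mem | apply zsmul_mem

theorem subseq_mem_span_nine {a : ℕ → ℤ} (h : Relations a) (e c : ℕ) (hc : c < 2 ^ e)
    (hne : ¬ (c = 0 ∧ e ≤ 2)) : subseq a (2 ^ e) c ∈ Submodule.span ℤ (nine a) := by
  induction e generalizing c with
  | zero => exact absurd ⟨by simpa using hc, by norm_num⟩ hne
  | succ e ih =>
    rw [pow_succ] at hc ⊢
    -- Removing the leading bit of c may lead to one of the three excluded sequences; their sections
    -- are then checked directly.
    by_cases h0 : c % 2 ^ e = 0 ∧ e ≤ 2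
    · obtain ⟨h0, he⟩ := h0
      have g21 : subseq a 2 1 ∈ nine a := by simp [nine]
      have g42 : subseq a 4 2 ∈ nine a := by simp [nine]
      have g80 : subseq a 8 0 ∈ nine a := by simp [nine]
      have g83 : subseq a 8 3 ∈ nine a := by simp [nine]
      have g43 : subseq a 4 3 ∈ nine a := by simp [nine]
      interval_cases e
      · obtain rfl : c = 1 := by omega
        exact Submodule.subset_span g21
      · obtain rfl : c = 2 := by omega
        exact Submodule.subset_span g42
      · obtain rfl | rfl : c = 0 ∨ c = 4 := by omega
        · exact Submodule.subset_span g80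
        · rw [show subseq a (2 ^ 2 * 2) 4 = subseq a 8 3 + subseq a 4 3 - subseq a 4 2 from
            funext h.2.1]
          exact sub_mem (add_mem (Submodule.subset_span g83) (Submodule.subset_span g43))
            (Submodule.subset_span g42)
    -- The leading bit c / 2^e selects the section of the sequence with residue c % 2^e.
    · have := subseq_bit_mem_span h (c / 2 ^ e) (Nat.div_lt_of_lt_mul hc)
        (ih (c % 2 ^ e) (Nat.mod_lt _ (by positivity)) h0)
      convert this using 1
      funext n
      have hd := Nat.div_add_mod c (2 ^ e)
      simp only [subseq]
      congr 1
      nth_rewrite 1 [← hd]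
      ring

theorem nine_subset_kernel (a : ℕ → ℤ) : nine a ⊆ kernel 2 a := by
  rintro b (rfl | rfl | rfl | rfl | rfl | rfl | rfl | rfl | rfl)
  exacts [⟨1, 1, by norm_num, rfl⟩, ⟨2, 2, by norm_num, rfl⟩, ⟨2, 3, by norm_num, rfl⟩,
    ⟨3, 0, by norm_num, rfl⟩, ⟨3, 2, by norm_num, rfl⟩, ⟨3, 3, by norm_num, rfl⟩,
    ⟨3, 6, by norm_num, rfl⟩, ⟨3, 7, by norm_num, rfl⟩, ⟨4, 3, by norm_num, rfl⟩]

theorem span_kernel_eq {a : ℕ → ℤ} (h : Relations a) :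
    Submodule.span ℤ (kernel 2 a) =
      Submodule.span ℤ (nine a ∪ {subseq a 1 0, subseq a 2 0, subseq a 4 0}) := by
  apply le_antisymm <;> rw [Submodule.span_le]
  · rintro b ⟨e, c, hc, rfl⟩
    by_cases h0 : c = 0 ∧ e ≤ 2
    · obtain ⟨rfl, he⟩ := h0
      refine Submodule.subset_span (Or.inr ?_)
      interval_cases e <;> simp
    · exact Submodule.span_mono Set.subset_union_left (subseq_mem_span_nine h e c hc h0)
  · refine Set.Subset.trans (Set.union_subset (nine_subset_kernel a) ?_) Submodule.subset_span
    rintro b (rfl | rfl | rfl)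
    exacts [⟨0, 0, by norm_num, rfl⟩, ⟨1, 0, by norm_num, rfl⟩, ⟨2, 0, by norm_num, rfl⟩]

theorem isRegular_of_relations {a : ℕ → ℤ} (h : Relations a) : IsRegular 2 a := by
  unfold IsRegular
  rw [span_kernel_eq h]
  exact Submodule.fg_span (Set.Finite.union (by simp [nine]) (by simp))

end TwoAbelian

/-- (1) The 2-abelian complexity `P` of the Thue–Morse word is 2-regular.
(2) It satisfies the 13 relations for all `n ≥ 0`.
(3) The 13 relations express every kernel subsequence `a (2^e n + c)`, apart from the three
subsequences `a n`, `a (2 n)`, `a (4 n)`, as a `ℤ`-combination of the nine fixed ones.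
(4) Hence the module generated by the 2-kernel of `P` is generated by these three subsequences and
the nine. -/
theorem theorem1 :
    TwoAbelian.IsRegular 2 TwoAbelian.P ∧
    TwoAbelian.Relations TwoAbelian.P ∧
    (∀ a : ℕ → ℤ, TwoAbelian.Relations a → ∀ e c : ℕ, c < 2 ^ e →
      ¬ (c = 0 ∧ e ≤ 2) →
        TwoAbelian.subseq a (2 ^ e) c ∈ Submodule.span ℤ (TwoAbelian.nine a)) ∧
    Submodule.span ℤ (TwoAbelian.kernel 2 TwoAbelian.P) =
      Submodule.span ℤ (TwoAbelian.nine TwoAbelian.P ∪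
        {TwoAbelian.subseq TwoAbelian.P 1 0, TwoAbelian.subseq TwoAbelian.P 2 0,
          TwoAbelian.subseq TwoAbelian.P 4 0}) :=
  ⟨TwoAbelian.isRegular_of_relations TwoAbelian.relations_P, TwoAbelian.relations_P,
    fun _ h e c hc hne => TwoAbelian.subseq_mem_span_nine h e c hc hne,
    TwoAbelian.span_kernel_eq TwoAbelian.relations_P⟩
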